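/- Let $L$ be a finite (non-empty) lattice. Write $a\lessdot b$ if $a$ is covered by $b$, i.e. $a<b$ and no $c$ satisfies $a<c<b$. A join-irreducible element is an element $j$ other than the least one such that $j=a\vee b$ implies $j\in\{a,b\}$; its unique lower cover is denoted $j_*$. The lattice $L$ is congruence uniform if, both for $L$ and for its dual lattice, there is a bijection between the set of join-irreducible elements of the lattice and the set of join-irreducible elements of its lattice of congruences. Assume that $L$ is congruence uniform. For $x\in L$ let $\Gamma(x)$ be the canonical join representation of $x$, i.e. the set $X\subseteq L$ with $\bigvee X=x$ such that no proper subset of $X$ joins to $x$ and such that, for every $Y\subseteq L$ with $\bigvee Y=x$, every element of $X$ is below some element of $Y$. Two cover relations $a\lessdot b$ and $c\lessdot d$ are perspective if either $d\vee a=b$ and $d\wedge a=c$, or $c\vee b=d$ and $c\wedge b=a$. For a cover relation $u\lessdot v$ let $\gamma(u,v)$ be the unique join-irreducible element $j$ such that $u\lessdot v$ and $j_*\lessdot j$ are perspective. Let $x_\downarrow=\bigwedge_{y\lessdot x}y$ be the meet of all lower covers of $x$ (the greatest element of $L$ if there are none), and let $$\Psi(x)=\{\gamma(u,v)\mid x_\downarrow\le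 u\lessdot v\le x\}.$$ ($\Gamma(x)$ and $\gamma(u,v)$ exist and are unique for every finite congruence-uniform lattice.) The Boolean defect of $L$ is $\mathrm{bdef}(L)=\sum_{x\in L}|\Psi(x)\setminus\Gamma(x)|$. Proposition 3.6. A finite congruence-uniform lattice $L$ satisfies $\mathrm{bdef}(L)=0$ if and only if $L$ is distributive, i.e. if and only if $x\wedge(y\vee z)=(x\wedge y)\vee(x\wedge z)$ and $x\vee(y\wedge z)=(x\vee y)\wedge(x\vee z)$ for all $x,y,z\in L$. -/

import Mathlib

open scoped Classical in
/-- The nucleus `x↓` of `x`: the meet of all lower covers of `x` (so it is the greatest element if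
`x` has no lower cover). -/
noncomputable def nucleus {L : Type*} [Lattice L] [BoundedOrder L] [Fintype L] (x : L) : L :=
  (Finset.univ.filter fun y : L => y ⋖ x).inf id

/-- The lattice is distributive: both distributive identities hold. -/
def IsDistributiveLattice (L : Type*) [Lattice L] : Prop :=
  ∀ x y z : L, x ⊓ (y ⊔ z) = (x ⊓ y) ⊔ (x ⊓ z) ∧ x ⊔ (y ⊓ z) = (x ⊔ y) ⊓ (x ⊔ z)

section Congruences

variable {L : Type*} [Lattice L]

theorem LatticeCon.toSetoid_inj :
    Function.Injective (LatticeCon.toSetoid : LatticeCon L → Setoid L) := by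
  intro c d h
  cases c
  cases d
  cases h
  rfl

/-- Lattice congruences ordered by inclusion. -/
instance LatticeCon.instPartialOrderIncl : PartialOrder (LatticeCon L) :=
  PartialOrder.lift LatticeCon.toSetoid LatticeCon.toSetoid_inj

/-- Infima of congruences are intersections. -/
instance LatticeCon.instInfSetInter : InfSet (LatticeCon L) :=
  ⟨fun S =>
    { r := fun x y => ∀ c ∈ S, c.r x y
      iseqv := ⟨fun x c _ => c.iseqv.refl x, fun h c hc => c.iseqv.symm (h c hc),
        fun h h' c hc => c.iseqv.trans (h c hc) (h' c hc)⟩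
      inf := fun h h' c hc => c.inf (h c hc) (h' c hc)
      sup := fun h h' c hc => c.sup (h c hc) (h' c hc) }⟩

/-- The congruence lattice `Con(L)`: all lattice congruences of `L`, ordered by inclusion. -/
instance LatticeCon.instCompleteLatticeIncl : CompleteLattice (LatticeCon L) :=
  completeLatticeOfInf (LatticeCon L) fun _ =>
    ⟨fun _ hc _ _ h => h _ hc, fun _ hd _ _ h c hc => hd hc h⟩

theorem LatticeCon.incl_iff {c d : LatticeCon L} :
    c ≤ d ↔ ∀ x y : L, c.r x y → d.r x y :=
  ⟨fun h _ _ hxy => h hxy, fun h x y hxy => h x y hxy⟩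

end Congruences

/-- There is a bijection between the join-irreducible elements of `L` and the join-irreducible
elements of the congruence lattice of `L`. (`SupIrred` excludes the least element.) -/
def HasJoinIrredCongruenceBijection (L : Type*) [Lattice L] : Prop :=
  Nonempty ({j : L // SupIrred j} ≃ {θ : LatticeCon L // SupIrred θ})

/-- A (finite) lattice is congruence uniform if, both for it and for its dual, there is a bijection
between the join-irreducible elements and the join-irreducible congruences. -/
def IsCongruenceUniform (L : Type*) [Lattice L] : Prop :=
  HasJoinIrredCongruenceBijection L ∧ HasJoinIrredCongruenceBijection Lᵒᵈ

section JoinRepresentations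

variable {L : Type*} [Lattice L]

/-- `X` is the canonical join representation of `x`: it joins to `x`, it is irredundant (no proper
subset joins to `x`), and the order ideal it generates is contained in the order ideal generated
by any other set that joins to `x`. -/
structure IsCanonicalJoinRep (x : L) (X : Set L) : Prop where
  isLUB : IsLUB X x
  irredundant : ∀ Y : Set L, Y ⊂ X → ¬ IsLUB Y x
  le_of_isLUB : ∀ Y : Set L, IsLUB Y x → lowerClosure X ≤ lowerClosure Y

/-- An element of a canonical join representation is not below a different one. -/
theorem IsCanonicalJoinRep.eq_of_le {x : L} {X : Set L} (h : IsCanonicalJoinRep x X) {a b : L}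
    (ha : a ∈ X) (hb : b ∈ X) (hab : a ≤ b) : a = b := by
  by_contra hne
  refine h.irredundant (X \ {a}) ⟨Set.sdiff_subset, fun hs => (hs ha).2 rfl⟩
    ⟨fun y hy => h.isLUB.1 hy.1, fun u hu => h.isLUB.2 fun y hy => ?_⟩
  by_cases hya : y = a
  · subst hya
    exact hab.trans (hu ⟨hb, fun hba => hne hba.symm⟩)
  · exact hu ⟨hy, hya⟩

/-- A canonical join representation is unique. -/
theorem IsCanonicalJoinRep.unique {x : L} {X Y : Set L} (hX : IsCanonicalJoinRep x X)
    (hY : IsCanonicalJoinRep x Y) : X = Y := by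
  have key : ∀ {X Y : Set L}, IsCanonicalJoinRep x X → IsCanonicalJoinRep x Y → X ⊆ Y := by
    intro X Y hX hY a ha
    obtain ⟨b, hb, hab⟩ := hX.le_of_isLUB Y hY.isLUB (subset_lowerClosure ha)
    obtain ⟨c, hc, hbc⟩ := hY.le_of_isLUB X hX.isLUB (subset_lowerClosure hb)
    have hac : a = c := hX.eq_of_le ha hc (hab.trans hbc)
    have hab' : a = b := le_antisymm hab (hac ▸ hbc)
    exact hab' ▸ hb
  exact (key hX hY).antisymm (key hY hX)

/-- `Γ(x)`: the canonical join representation of `x` (empty if there is none). -/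
def canonicalJoinands (x : L) : Set L :=
  {j | ∃ X : Set L, IsCanonicalJoinRep x X ∧ j ∈ X}

theorem IsCanonicalJoinRep.canonicalJoinands_eq {x : L} {X : Set L}
    (h : IsCanonicalJoinRep x X) : canonicalJoinands x = X := by
  ext j
  exact ⟨fun ⟨_, hY, hj⟩ => hY.unique h ▸ hj, fun hj => ⟨X, h, hj⟩⟩

/-- The cover relations `(x, y)` and `(u, v)` are perspective. -/
def Perspective (x y u v : L) : Prop :=
  (v ⊔ x = y ∧ v ⊓ x = u) ∨ (u ⊔ y = v ∧ u ⊓ y = x)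

/-- `j` is the label `γ(u, v)` of the cover relation `u ⋖ v`: it is join irreducible and `(u, v)` is
perspective to `(j⁎, j)`, where `j⁎` is the unique lower cover of `j`. In a finite
congruence-uniform lattice every cover relation has exactly one label. -/
def IsCoverLabel (u v j : L) : Prop :=
  SupIrred j ∧ ∃ jₛ : L, jₛ ⋖ j ∧ Perspective u v jₛ j

end JoinRepresentations

/-- `Ψ(x)`: the set of core labels of `x`, i.e. of the labels of all cover relations in the
interval `[x↓, x]`. -/
def coreLabels {L : Type*} [Lattice L] [BoundedOrder L] [Fintype L] (x : L) : Set L :=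
  {j | ∃ u v : L, nucleus x ≤ u ∧ u ⋖ v ∧ v ≤ x ∧ IsCoverLabel u v j}

/-- The Boolean defect `∑ x, |Ψ(x) \ Γ(x)|`. -/
noncomputable def booleanDefect (L : Type*) [Lattice L] [BoundedOrder L] [Fintype L] : ℕ :=
  ∑ x : L, (coreLabels x \ canonicalJoinands x).ncard

/-! The Boolean defect vanishes iff Ψ(x) ⊆ Γ(x) for all x, and distributivity amounts to every join
irreducible being join prime.

If Ψ ⊆ Γ, two distinct lower covers of x each cover their meet: a longer chain would yield two
canonical joinands of x not below the same lower cover (`inf_covBy_of_coreLabels_subset`). In the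
resulting lower semimodular lattice, every m maximal with j ≰ m is meet irreducible and is
contracted by the same congruences as j. Congruence uniformity of the dual makes m unique, so j is
prime (`supPrime_of_lowerSemimodular`).

Conversely, in a distributive lattice Γ(x) consists of the maximal join irreducibles below x, and
primeness makes every core label maximal (`coreLabels_subset_of_isDistributiveLattice`). -/

theorem SupIrred.le_of_covBy {L : Type*} [Lattice L] {j a x : L} (hj : SupIrred j)
    (ha : a ⋖ j) (hx : x < j) : x ≤ a := by
  by_contra hxa
  have h : x ⊔ a = j := ha.eq_or_eq le_sup_right (sup_le hx.le ha.le) |>.resolve_left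
    fun h => hxa (h ▸ le_sup_left)
  rcases hj.2 h with h | h
  · exact hx.ne h
  · exact ha.ne h

theorem IsCoverLabel.le_and_not_le {L : Type*} [Lattice L] {u v j : L}
    (h : IsCoverLabel u v j) (huv : u ⋖ v) : j ≤ v ∧ ¬ j ≤ u := by
  obtain ⟨hj, a, ha, ⟨h₁, h₂⟩ | ⟨h₁, h₂⟩⟩ := h
  · exact ⟨h₁ ▸ le_sup_left, fun hju => ha.ne (h₂.symm.trans (inf_eq_left.2 hju))⟩
  -- Here v ≤ j. Were v < j, it would lie below the lower cover a, which forces u = v.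
  · have hv : v = j := by
      by_contra hne
      have hva : v ≤ a := hj.le_of_covBy ha ((h₁ ▸ le_sup_right : v ≤ j).lt_of_ne hne)
      exact huv.ne (h₂.symm.trans (inf_eq_right.2 hva))
    exact ⟨hv.ge, fun hju => huv.lt.not_ge (hv ▸ hju)⟩

/-! ### Separation by join irreducibles, and lower semimodularity -/

section FiniteLattice

variable {L : Type*} [Lattice L] [Finite L]

/-- A minimal element not below b works: everything strictly smaller is below b, hence so is any
join of such elements. -/
theorem exists_supIrred_of_not_le {a b : L} (h : ¬ a ≤ b) :
    ∃ j, SupIrred j ∧ j ≤ a ∧ ¬ j ≤ b ∧ ∀ x < j, x ≤ b := by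
  obtain ⟨j, hja, hj⟩ := (Set.toFinite {j : L | ¬ j ≤ b}).exists_le_minimal h
  have hlt : ∀ x < j, x ≤ b := fun x hx => by
    by_contra hxb
    exact hx.not_ge (hj.2 hxb hx.le)
  refine ⟨j, ⟨fun hmin => hj.1 ?_, fun c d hcd => ?_⟩, hja, hj.1, hlt⟩
  · exact (hmin (inf_le_left : j ⊓ b ≤ j)).trans inf_le_right
  · by_contra! hne
    have hc : c ≤ j := hcd ▸ le_sup_left
    have hd : d ≤ j := hcd ▸ le_sup_right
    exact hj.1 (hcd ▸ sup_le (hlt c (hc.lt_of_ne hne.1)) (hlt d (hd.lt_of_ne hne.2)))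

theorem SupIrred.exists_covBy {j : L} (hj : SupIrred j) : ∃ a, a ⋖ j := by
  obtain ⟨b, hb⟩ := not_isMin_iff.1 hj.1
  obtain ⟨a, -, ha⟩ := exists_le_covBy_of_lt hb
  exact ⟨a, ha⟩

/-- Every cover relation has a label, which lies below the upper but not below the lower element. -/
theorem exists_isCoverLabel {u v : L} (h : u ⋖ v) :
    ∃ j, IsCoverLabel u v j ∧ j ≤ v ∧ ¬ j ≤ u := by
  obtain ⟨j, hj, hjv, hju, hlt⟩ := exists_supIrred_of_not_le h.lt.not_ge
  obtain ⟨a, ha⟩ := hj.exists_covBy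
  refine ⟨j, ⟨hj, a, ha, Or.inl ⟨?_, ?_⟩⟩, hjv, hju⟩
  · exact (h.eq_or_eq le_sup_right (sup_le hjv h.le)).resolve_left
      fun h => hju (h ▸ le_sup_left)
  · exact (ha.eq_or_eq (le_inf ha.le (hlt a ha.lt)) inf_le_left).resolve_right
      fun h => hju (h ▸ inf_le_right)

/-- In a finite lattice, weak lower semimodularity implies lower semimodularity. -/
theorem inf_covBy_of_covBy_of_not_le
    (hL : ∀ x y z : L, y ⋖ x → z ⋖ x → y ≠ z → y ⊓ z ⋖ z) (x : L) :
    ∀ y c : L, y ⋖ x → c ≤ x → ¬ c ≤ y → y ⊓ c ⋖ c := by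
  induction x using (wellFounded_lt (α := L)).induction with
  | _ x ih =>
    intro y c hy hc hcy
    rcases hc.eq_or_lt with rfl | hc
    · rwa [inf_eq_left.2 hy.le]
    -- Descend to a lower cover z of x above c; there y ⊓ z replaces y and has the same meet with c.
    obtain ⟨z, hcz, hz⟩ := exists_le_covBy_of_lt hc
    have h := ih z hz.lt (y ⊓ z) c (hL x y z hy hz fun e => hcy (e ▸ hcz)) hcz
      fun h => hcy (h.trans inf_le_left)
    rwa [inf_assoc, inf_eq_right.2 hcz] at h

theorem isDistributiveLattice_of_supPrime (h : ∀ j : L, SupIrred j → SupPrime j) :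
    IsDistributiveLattice L := by
  have key : ∀ x y z : L, x ⊓ (y ⊔ z) ≤ (x ⊓ y) ⊔ (x ⊓ z) := by
    intro x y z
    by_contra hle
    obtain ⟨j, hj, h₁, h₂, -⟩ := exists_supIrred_of_not_le hle
    rcases (h j hj).2 (h₁.trans inf_le_right) with h₃ | h₃
    · exact h₂ ((le_inf (h₁.trans inf_le_left) h₃).trans le_sup_left)
    · exact h₂ ((le_inf (h₁.trans inf_le_left) h₃).trans le_sup_right)
  let _ := DistribLattice.ofInfSupLe key
  exact fun x y z => ⟨inf_sup_left x y z, sup_inf_left x y z⟩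

end FiniteLattice

/-! ### Join-irreducible congruences -/

section Congruences

variable {L : Type*} [Lattice L]

/-- The principal congruence generated by a pair. -/
def principalCon (a b : L) : LatticeCon L := sInf {c | c.r a b}

theorem principalCon_le {a b : L} {c : LatticeCon L} : principalCon a b ≤ c ↔ c.r a b :=
  ⟨fun h => LatticeCon.incl_iff.1 h a b fun _ hd => hd, fun h => sInf_le h⟩

/-- A congruence of a finite lattice is determined by the join irreducibles that it contracts. -/
theorem LatticeCon.le_of_contracts [Finite L] {c d : LatticeCon L}
    (h : ∀ a j : L, SupIrred j → a ⋖ j → c.r a j → d.r a j) : c ≤ d := by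
  have key : ∀ y x : L, x ≤ y → c.r x y → d.r x y := by
    intro y x
    induction x using (wellFounded_gt (α := L)).induction with
    | _ x ih =>
      intro hxy hc
      rcases hxy.eq_or_lt with rfl | hlt
      · exact d.iseqv.refl _
      obtain ⟨j, hj, hjy, hjx, hlow⟩ := exists_supIrred_of_not_le hlt.not_ge
      obtain ⟨a, ha⟩ := hj.exists_covBy
      have hjx' : x ⊓ j = a := (ha.eq_or_eq (le_inf (hlow a ha.lt) ha.le)
        inf_le_right).resolve_right fun h => hjx (h ▸ inf_le_left)
      -- Meeting with j carries x ~ y to a ~ j, and joining with x carries this back to x ~ j ⊔ x, a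
      -- strict step up towards y.
      have h₁ : c.r a j := by
        have := c.inf hc (c.iseqv.refl j)
        rwa [hjx', inf_eq_right.2 hjy] at this
      have h₂ : d.r x (j ⊔ x) := by
        have := d.sup (h a j hj ha h₁) (d.iseqv.refl x)
        rwa [sup_eq_right.2 (hlow a ha.lt)] at this
      have h₃ : c.r (j ⊔ x) y := by
        have := c.sup (c.iseqv.refl j) hc
        rwa [sup_eq_right.2 hjy] at this
      exact d.iseqv.trans h₂ (ih _ (right_lt_sup.2 hjx) (sup_le hjy hxy) h₃)
  refine LatticeCon.incl_iff.2 fun x y hxy => ?_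
  have h₁ : c.r x (x ⊔ y) := by
    simpa using c.sup (c.iseqv.refl x) hxy
  have h₂ : c.r y (x ⊔ y) := by
    simpa using c.sup (c.iseqv.symm hxy) (c.iseqv.refl y)
  exact d.iseqv.trans (key _ _ le_sup_left h₁) (d.iseqv.symm (key _ _ le_sup_right h₂))

/-- Any c is the finite join of the principal congruences of the pairs (a, j) it contracts; an
irreducible c equals one of them. -/
theorem exists_principalCon_eq [Finite L] {c : LatticeCon L} (hc : SupIrred c) :
    ∃ j a : L, SupIrred j ∧ a ⋖ j ∧ principalCon a j = c := by
  classical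
  have := Fintype.ofFinite L
  let s : Finset (L × L) := Finset.univ.filter fun p => SupIrred p.2 ∧ p.1 ⋖ p.2 ∧ c.r p.1 p.2
  have hs : s.sup (fun p => principalCon p.1 p.2) = c := by
    refine le_antisymm (Finset.sup_le fun p hp => ?_) (LatticeCon.le_of_contracts ?_)
    · exact principalCon_le.2 (Finset.mem_filter.1 hp).2.2.2
    · intro a j hj ha haj
      exact principalCon_le.1 (Finset.le_sup (f := fun p : L × L => principalCon p.1 p.2)
        (Finset.mem_filter.2 ⟨Finset.mem_univ (a, j), hj, ha, haj⟩))
  obtain ⟨p, hp, h⟩ := hc.finset_sup_eq hs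
  obtain ⟨-, h₁, h₂, -⟩ := Finset.mem_filter.1 hp
  exact ⟨p.2, p.1, h₁, h₂, h⟩

/-- If join irreducibles and join-irreducible congruences are equinumerous, then a join irreducible
is determined by the congruences that contract it. -/
theorem HasJoinIrredCongruenceBijection.eq_of_contracts_iff [Finite L]
    (hL : HasJoinIrredCongruenceBijection L) {j a k b : L} (hj : SupIrred j) (ha : a ⋖ j)
    (hk : SupIrred k) (hb : b ⋖ k) (h : ∀ c : LatticeCon L, c.r a j ↔ c.r b k) : j = k := by
  obtain ⟨e⟩ := hL
  have hex : ∀ c : {c : LatticeCon L // SupIrred c}, ∃ i : {j : L // SupIrred j},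
      ∃ a : L, a ⋖ i.1 ∧ principalCon a i.1 = c.1 := fun c =>
    let ⟨j, a, hj, ha, hc⟩ := exists_principalCon_eq c.2
    ⟨⟨j, hj⟩, a, ha, hc⟩
  choose g l hl hg using hex
  have hlow : ∀ {i x y : L}, SupIrred i → x ⋖ i → y ⋖ i → x = y := fun hi hx hy =>
    le_antisymm (hi.le_of_covBy hy hx.lt) (hi.le_of_covBy hx hy.lt)
  have hinj : Function.Injective g := by
    intro c d hcd
    have h₁ := hg c
    have h₂ : l c = l d := hlow (g c).2 (hl c) (hcd ▸ hl d)
    rw [hcd, h₂, hg d] at h₁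
    exact Subtype.ext h₁.symm
  -- The given bijection `e` is arbitrary and serves only for counting: the injective `g` must hit
  -- every join irreducible.
  have hsurj : Function.Surjective g := by
    have := Finite.injective_iff_surjective (f := g ∘ e) |>.1 (hinj.comp e.injective)
    exact this.of_comp
  obtain ⟨c, hc⟩ := hsurj ⟨j, hj⟩
  obtain ⟨d, hd⟩ := hsurj ⟨k, hk⟩
  have hcj : (g c).1 = j := congrArg Subtype.val hc
  have hdk : (g d).1 = k := congrArg Subtype.val hd
  have hca : l c = a := hlow hj (hcj ▸ hl c) ha
  have hdb : l d = b := hlow hk (hdk ▸ hl d) hb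
  have h₁ := hg c
  have h₂ := hg d
  rw [hcj, hca] at h₁
  rw [hdk, hdb] at h₂
  have hcd : c = d := Subtype.ext <| by
    rw [← h₁, ← h₂]
    exact le_antisymm (principalCon_le.2 ((h _).2 (principalCon_le.1 le_rfl)))
      (principalCon_le.2 ((h _).1 (principalCon_le.1 le_rfl)))
  rw [← hcj, ← hdk, hcd]

end Congruences

/-! ### Join primeness from lower semimodularity -/

section LowerSemimodular

variable {L : Type*} [Lattice L] [Finite L]

theorem supPrime_of_lowerSemimodular (hdual : HasJoinIrredCongruenceBijection Lᵒᵈ)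
    (hL : ∀ x y z : L, y ⋖ x → z ⋖ x → y ≠ z → y ⊓ z ⋖ z) {j : L} (hj : SupIrred j) :
    SupPrime j := by
  obtain ⟨a, ha⟩ := hj.exists_covBy
  have key : ∀ m : L, Maximal (fun x => ¬ j ≤ x) m →
      SupIrred (OrderDual.toDual m) ∧ OrderDual.toDual (m ⊔ j) ⋖ OrderDual.toDual m ∧
        ∀ c : LatticeCon Lᵒᵈ, c.r (OrderDual.toDual (m ⊔ j)) (OrderDual.toDual m) ↔
          c.r (OrderDual.toDual j) (OrderDual.toDual a) := by
    intro m hm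
    have hgt : ∀ x, m < x → j ≤ x := fun x hx => by
      by_contra hjx
      exact hx.not_ge (hm.2 hjx hx.le)
    have hcov : m ⋖ m ⊔ j := ⟨left_lt_sup.2 hm.1, fun x h₁ h₂ =>
      h₂.not_ge (sup_le h₁.le (hgt x h₁))⟩
    -- Only here does semimodularity enter: m ⊓ j is a lower cover of j, hence the only one. So (m,
    -- m ⊔ j) and (a, j) are perspective and are contracted by the same congruences.
    have hinf : m ⊓ j = a := by
      have h := inf_covBy_of_covBy_of_not_le hL (m ⊔ j) m j hcov le_sup_right hm.1
      exact le_antisymm (hj.le_of_covBy ha h.lt) (hj.le_of_covBy h ha.lt)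
    have ham : a ≤ m := hinf ▸ inf_le_left
    refine ⟨⟨fun hmax => ?_, fun x y hxy => ?_⟩, hcov.toDual, fun c => ⟨fun hc => ?_, fun hc => ?_⟩⟩
    · exact hm.1 (le_sup_right.trans
        (hmax (show OrderDual.toDual (m ⊔ j) ≤ OrderDual.toDual m from hcov.le)))
    · by_contra! hne
      have hxy' : OrderDual.ofDual x ⊓ OrderDual.ofDual y = m := hxy
      have hx : m ≤ OrderDual.ofDual x := hxy' ▸ inf_le_left
      have hy : m ≤ OrderDual.ofDual y := hxy' ▸ inf_le_right
      exact hm.1 (hxy' ▸ le_inf (hgt _ (hx.lt_of_ne fun e => hne.1 e.symm))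
        (hgt _ (hy.lt_of_ne fun e => hne.2 e.symm)))
    · have := c.sup hc (c.iseqv.refl (OrderDual.toDual j))
      rwa [← toDual_inf, ← toDual_inf, hinf, inf_eq_right.2 le_sup_right] at this
    · have := c.inf (c.iseqv.refl (OrderDual.toDual m)) hc
      rwa [← toDual_sup, ← toDual_sup, sup_eq_left.2 ham] at this
  refine ⟨hj.1, fun b c hbc => ?_⟩
  by_contra! hne
  -- If j is below neither b nor c, extend both to maximal elements not above j. These coincide, so
  -- b ⊔ c is not above j either.
  obtain ⟨m, hbm, hm⟩ := (Set.toFinite {x : L | ¬ j ≤ x}).exists_le_maximal hne.1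
  obtain ⟨n, hcn, hn⟩ := (Set.toFinite {x : L | ¬ j ≤ x}).exists_le_maximal hne.2
  obtain ⟨h₁, h₂, h₃⟩ := key m hm
  obtain ⟨h₄, h₅, h₆⟩ := key n hn
  have hmn : m = n := OrderDual.toDual.injective <|
    hdual.eq_of_contracts_iff h₁ h₂ h₄ h₅ fun c => (h₃ c).trans (h₆ c).symm
  exact hm.1 (hbc.trans (sup_le hbm (hmn ▸ hcn)))

end LowerSemimodular

/-! ### Core labels against canonical joinands -/

section CanonicalJoinRepresentations

variable {L : Type*} [Lattice L]

theorem CovBy.sup_eq_of_not_le {x y i : L} (hy : y ⋖ x) (hi : i ≤ x) (hiy : ¬ i ≤ y) :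
    i ⊔ y = x :=
  (hy.eq_or_eq le_sup_right (sup_le hi hy.le)).resolve_left fun h => hiy (h ▸ le_sup_left)

theorem IsCanonicalJoinRep.le_or_le {x y z : L} {X : Set L} (hX : IsCanonicalJoinRep x X)
    (h : y ⊔ z = x) {i : L} (hi : i ∈ X) : i ≤ y ∨ i ≤ z := by
  have hlub : IsLUB {y, z} x := h ▸ isLUB_pair
  obtain ⟨w, hw, hiw⟩ := hX.le_of_isLUB _ hlub (subset_lowerClosure hi)
  rcases hw with rfl | rfl
  · exact Or.inl hiw
  · exact Or.inr hiw

/-- At most one canonical joinand is not below a given lower cover. -/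
theorem IsCanonicalJoinRep.eq_of_not_le {x y : L} {X : Set L} (hX : IsCanonicalJoinRep x X)
    (hy : y ⋖ x) {i k : L} (hi : i ∈ X) (hk : k ∈ X) (hiy : ¬ i ≤ y) (hky : ¬ k ≤ y) : i = k :=
  hX.eq_of_le hi hk ((hX.le_or_le (hy.sup_eq_of_not_le (hX.isLUB.1 hk) hky) hi).resolve_right hiy)

/-- Labels on a chain from y ⊓ z to z are not below y, and as canonical joinands of x they must all
coincide. But for y ⊓ z ⋖ v ⋖ w ≤ z the first label is below v and the second is not. -/
theorem inf_covBy_of_coreLabels_subset [BoundedOrder L] [Fintype L]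
    (h : ∀ x : L, coreLabels x ⊆ canonicalJoinands x) {x y z : L} (hy : y ⋖ x) (hz : z ⋖ x)
    (hyz : y ≠ z) : y ⊓ z ⋖ z := by
  have hnuc : nucleus x ≤ y ⊓ z := le_inf
    (Finset.inf_le (f := id) (by simpa using hy)) (Finset.inf_le (f := id) (by simpa using hz))
  have hlt : y ⊓ z < z := inf_lt_right.2 fun hzy =>
    (hz.eq_or_eq hzy hy.le).elim hyz hy.ne
  have key : ∀ u v, y ⊓ z ≤ u → u ⋖ v → v ≤ z →
      ∃ X j, IsCanonicalJoinRep x X ∧ j ∈ X ∧ j ≤ v ∧ ¬ j ≤ u ∧ ¬ j ≤ y := by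
    intro u v hu huv hv
    obtain ⟨j, hj, hjv, hju⟩ := exists_isCoverLabel huv
    obtain ⟨X, hX, hjX⟩ := h x ⟨u, v, hnuc.trans hu, huv, hv.trans hz.le, hj⟩
    exact ⟨X, j, hX, hjX, hjv, hju, fun hjy => hju ((le_inf hjy (hjv.trans hv)).trans hu)⟩
  obtain ⟨v, huv, hvz⟩ := exists_covBy_le_of_lt hlt
  rcases hvz.eq_or_lt with rfl | hvz'
  · exact huv
  obtain ⟨w, hvw, hwz⟩ := exists_covBy_le_of_lt hvz'
  obtain ⟨X, i, hX, hiX, hiv, -, hiy⟩ := key _ v le_rfl huv hvz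
  obtain ⟨Y, k, hY, hkY, -, hkv, hky⟩ := key v w huv.le hvw hwz
  obtain rfl := hX.unique hY
  exact absurd (hX.eq_of_not_le hy hiX hkY hiy hky ▸ hiv) hkv

end CanonicalJoinRepresentations

/-! ### The distributive case -/

section Distributive

theorem supPrime_of_isDistributiveLattice {L : Type*} [Lattice L] (hL : IsDistributiveLattice L)
    {j : L} (hj : SupIrred j) : SupPrime j := by
  refine ⟨hj.1, fun b c hbc => ?_⟩
  have h := (hL j b c).1
  rw [inf_eq_left.2 hbc] at h
  exact (hj.2 h.symm).imp inf_eq_left.1 inf_eq_left.1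

/-- In a finite distributive lattice, the canonical join representation of an element consists of
the maximal join irreducibles below it. -/
theorem isCanonicalJoinRep_maximal_supIrred {L : Type*} [Lattice L] [Finite L] [OrderBot L]
    (hL : IsDistributiveLattice L) (x : L) :
    IsCanonicalJoinRep x {j | Maximal (fun i => SupIrred i ∧ i ≤ x) j} := by
  have hle : ∀ Y : Set L, IsLUB Y x → ∀ j, SupIrred j → j ≤ x → ∃ y ∈ Y, j ≤ y := by
    intro Y hY j hj hjx
    have hYf := Set.toFinite Y
    have hx : hYf.toFinset.sup id = x := by
      refine (Finset.isLUB_sup_id).unique (by simpa using hY)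
    obtain ⟨y, hy, hjy⟩ := (supPrime_of_isDistributiveLattice hL hj).le_finset_sup.1
      (hjx.trans hx.ge)
    exact ⟨y, hYf.mem_toFinset.1 hy, hjy⟩
  refine ⟨⟨fun j hj => hj.1.2, fun u hu => ?_⟩, fun Y hYX hY => ?_, fun Y hY j hj => ?_⟩
  · by_contra hxu
    obtain ⟨j, hj, hjx, hju, -⟩ := exists_supIrred_of_not_le hxu
    obtain ⟨k, hjk, hk⟩ := (Set.toFinite {i : L | SupIrred i ∧ i ≤ x}).exists_le_maximal ⟨hj, hjx⟩
    exact hju (hjk.trans (hu hk))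
  · obtain ⟨j, hj, hjY⟩ := Set.exists_of_ssubset hYX
    obtain ⟨y, hy, hjy⟩ := hle Y hY j hj.1.1 hj.1.2
    exact hjY (hjy.antisymm (hj.2 (hYX.1 hy).1 hjy) ▸ hy)
  · obtain ⟨i, hi, hji⟩ := hj
    obtain ⟨y, hy, hiy⟩ := hle Y hY i hi.1.1 hi.1.2
    exact ⟨y, hy, hji.trans hiy⟩

/-- A core label j is not below the nucleus, so some lower cover y of x satisfies j ⊔ y = x. A join
irreducible k with j ≤ k ≤ x is prime and not below y, hence k ≤ j. -/
theorem coreLabels_subset_of_isDistributiveLattice {L : Type*} [Lattice L] [BoundedOrder L]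
    [Fintype L] (hL : IsDistributiveLattice L) (x : L) :
    coreLabels x ⊆ canonicalJoinands x := by
  rintro j ⟨u, v, hu, huv, hv, hj⟩
  rw [(isCanonicalJoinRep_maximal_supIrred hL x).canonicalJoinands_eq]
  obtain ⟨hjv, hju⟩ := hj.le_and_not_le huv
  have hjx := hjv.trans hv
  obtain ⟨y, hy, hjy⟩ : ∃ y, y ⋖ x ∧ ¬ j ≤ y := by
    by_contra! h
    exact hju ((Finset.le_inf fun y hy => h y (by simpa using hy)).trans hu)
  refine ⟨⟨hj.1, hjx⟩, fun k hk hjk => ?_⟩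
  have hkx : k ≤ j ⊔ y := (hy.sup_eq_of_not_le hjx hjy).symm ▸ hk.2
  exact ((supPrime_of_isDistributiveLattice hL hk.1).2 hkx).resolve_right
    fun hky => hjy (hjk.trans hky)

end Distributive

theorem booleanDefect_eq_zero_iff {L : Type*} [Lattice L] [BoundedOrder L] [Fintype L] :
    booleanDefect L = 0 ↔ ∀ x : L, coreLabels x ⊆ canonicalJoinands x := by
  simp [booleanDefect, Set.ncard_eq_zero (Set.toFinite _), Set.sdiff_eq_empty]

theorem proposition3p6 (L : Type*) [Lattice L] [BoundedOrder L] [Fintype L]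
    (hL : IsCongruenceUniform L) : booleanDefect L = 0 ↔ IsDistributiveLattice L := by
  rw [booleanDefect_eq_zero_iff]
  refine ⟨fun h => isDistributiveLattice_of_supPrime fun j hj => ?_,
    coreLabels_subset_of_isDistributiveLattice⟩
  exact supPrime_of_lowerSemimodular hL.2
    (fun _ _ _ hy hz hyz => inf_covBy_of_coreLabels_subset h hy hz hyz) hj
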